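/- Let $R$ be a Prüfer domain of finite character, that is, an integral domain such that for every maximal ideal $P$ the localization $R_P$ is a valuation ring (its ideals are linearly ordered by inclusion), and such that every non-zero element of $R$ is contained in only finitely many maximal ideals. Then, for every injective $R$-module $G$ and every multiplicative subset $S$ of $R$, the localization $S^{-1}G$ is injective, both as an $S^{-1}R$-module and as an $R$-module. -/

import Mathlib

universe u v

/-- A Prüfer domain: an integral domain that is arithmetical, i.e. all of whose localizations at
maximal ideals are valuation rings. -/
class IsPruferDomain (R : Type u) [CommRing R] : Prop extends IsDomain R where
  valuationRing_localization : ∀ (P : Ideal R) [P.IsMaximal],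
    ValuationRing (Localization.AtPrime P)

/-- A ring is of finite character if every non-zero element is contained in only finitely many
maximal ideals. -/
class IsOfFiniteCharacterRing (R : Type u) [CommRing R] : Prop where
  finite_maximal : ∀ a : R, a ≠ 0 → {P : Ideal R | P.IsMaximal ∧ a ∈ P}.Finite

/-! An injective module `G` over a domain is divisible, so `S⁻¹G` is the quotient of `G` by its
`S`-torsion `T`, as soon as `0 ∉ S`; the task is to verify Baer's criterion for `G ⧸ T`.

Over a valuation domain, let `L` be the largest prime ideal missing `S`. Then `T` is killed by `L`
and is the torsion submodule, over the domain `R ⧸ L`, of the injective module of elements of `G`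
killed by `L`, hence is itself injective over `R ⧸ L`. A map `f : I → G ⧸ T` from an ideal lifts
to `G`, because the pullback of `0 → T → G → G ⧸ T → 0` along `f` splits: `I` is flat, so reduction
modulo `L` keeps `T` a submodule, and there it splits off by injectivity. The lift extends to `R`.
This is `Module.Baer.quotient_torsion'_of_dvd_total`, formulated for `R`-modules on which the
complement of a prime `P` with `R_P` a valuation ring acts injectively.

In general, `G` is a direct summand of a product, over all maximal ideals `P`, of injective modules
`E P` on which the complement of `P` acts bijectively; products of copies of the Pontryagin duals
of the flat modules `R_P` serve (`evalLocalDual_injective`). Let `f` be a map from an ideal `I`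
into the quotient of this product by its `S`-torsion and let `a ∈ I` be non-zero. At the finitely
many `P` containing `a` the local case applies; at all others `a` is invertible on `E P`, so that
`f` is multiplication by `a⁻¹ f(a)`. The finitely many denominators at the former, together with
one for the latter, have a common multiple in `S` (`Module.Baer.quotient_torsion'_pi`).

The criterion over `S⁻¹R` follows from that over `R` by clearing denominators. -/

/-! ### Baer's criterion for torsion quotients -/

namespace Module.Baer

variable {R : Type*} [CommRing R] {M N : Type*} [AddCommGroup M] [AddCommGroup N]
  [Module R M] [Module R N]

theorem exists_eq_smul (h : Module.Baer R M) (I : Ideal R) (f : I →ₗ[R] M) :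
    ∃ x : M, ∀ i : I, f i = (i : R) • x := by
  obtain ⟨g, hg⟩ := h I f
  refine ⟨g 1, fun i => ?_⟩
  rw [← map_smul, smul_eq_mul, mul_one, hg i i.2]

theorem of_exists_eq_smul
    (h : ∀ (I : Ideal R) (f : I →ₗ[R] M), ∃ x : M, ∀ i : I, f i = (i : R) • x) :
    Module.Baer R M := fun I f => by
  obtain ⟨x, hx⟩ := h I f
  exact ⟨LinearMap.toSpanSingleton R M x, fun i hi => by simp [hx ⟨i, hi⟩]⟩

theorem of_leftInverse (h : Module.Baer R N) (j : M →ₗ[R] N) (r : N →ₗ[R] M)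
    (hrj : ∀ m, r (j m) = m) : Module.Baer R M := fun I f => by
  obtain ⟨g, hg⟩ := h I (j ∘ₗ f)
  exact ⟨r ∘ₗ g, fun x hx => by simp [hg x hx, hrj]⟩

theorem pi {ι : Type*} {E : ι → Type*} [∀ i, AddCommGroup (E i)] [∀ i, Module R (E i)]
    (h : ∀ i, Module.Baer R (E i)) : Module.Baer R (∀ i, E i) := fun I f => by
  choose g hg using fun i => h i I (LinearMap.proj i ∘ₗ f)
  exact ⟨LinearMap.pi g, fun x hx => funext fun i => hg i x hx⟩

theorem exists_smul_eq [IsDomain R] (h : Module.Baer R M) {a : R} (ha : a ≠ 0) (m : M) :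
    ∃ x : M, a • x = m := by
  obtain ⟨g, hg⟩ := h.extension_property (LinearMap.toSpanSingleton R R a)
    (fun x y hxy => mul_right_cancel₀ ha (by simpa using hxy))
    (LinearMap.toSpanSingleton R M m)
  refine ⟨g 1, ?_⟩
  have := LinearMap.congr_fun hg 1
  rw [← map_smul]
  simpa using this

/-- The quotient by `S`-torsion is functorial, so it preserves retracts. -/
theorem quotient_torsion'_of_leftInverse (S : Submonoid R)
    (h : Module.Baer R (N ⧸ Submodule.torsion' R N S)) (j : M →ₗ[R] N) (r : N →ₗ[R] M)
    (hrj : ∀ m, r (j m) = m) : Module.Baer R (M ⧸ Submodule.torsion' R M S) := by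
  refine h.of_leftInverse
    (Submodule.mapQ _ _ j ?_) (Submodule.mapQ _ _ r ?_) fun m => ?_
  · rintro m ⟨s, hs⟩
    exact ⟨s, by rw [Submonoid.smul_def] at hs ⊢; rw [← map_smul, hs, map_zero]⟩
  · rintro m ⟨s, hs⟩
    exact ⟨s, by rw [Submonoid.smul_def] at hs ⊢; rw [← map_smul, hs, map_zero]⟩
  · induction m using Submodule.Quotient.induction_on with
    | H m => simp [hrj]

/-- Over a domain, a Baer module is divisible, so that its localization is the quotient by the
`S`-torsion. -/
theorem localizedModule [IsDomain R] (h : Module.Baer R M) (S : Submonoid R) (hS : 0 ∉ S)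
    (hq : Module.Baer R (M ⧸ Submodule.torsion' R M S)) :
    Module.Baer R (LocalizedModule S M) := by
  have hker : LinearMap.ker (LocalizedModule.mkLinearMap S M) = Submodule.torsion' R M S := by
    ext m
    rw [LocalizedModule.mem_ker_mkLinearMap_iff, Submodule.mem_torsion'_iff]
    exact ⟨fun ⟨r, hr, e⟩ => ⟨⟨r, hr⟩, e⟩, fun ⟨r, e⟩ => ⟨r, r.2, e⟩⟩
  have hsurj : Function.Surjective (LocalizedModule.mkLinearMap S M) := fun y => by
    induction y using LocalizedModule.induction_on with
    | _ m s =>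
      obtain ⟨x, hx⟩ := h.exists_smul_eq (fun h0 : (s : R) = 0 => hS (h0 ▸ s.2)) m
      refine ⟨x, ?_⟩
      rw [LocalizedModule.mkLinearMap_apply, ← hx, LocalizedModule.mk_eq]
      exact ⟨1, by simp [Submonoid.smul_def]⟩
  exact hq.of_equiv ((Submodule.quotEquivOfEq _ _ hker.symm).trans
    ((LocalizedModule.mkLinearMap S M).quotKerEquivOfSurjective hsurj))

/-- A module over `S⁻¹R` satisfying Baer's criterion over `R` satisfies it over `S⁻¹R`: a map on
an ideal of `S⁻¹R` is determined by its values on the contraction of that ideal to `R`. -/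
theorem localization {S : Submonoid R} [Module (Localization S) M]
    [IsScalarTower R (Localization S) M] (h : Module.Baer R M) :
    Module.Baer (Localization S) M := by
  refine of_exists_eq_smul fun J f => ?_
  let I : Ideal R := J.comap (algebraMap R (Localization S))
  let ι : I →ₗ[R] J :=
    { toFun := fun i => ⟨algebraMap R (Localization S) i, i.2⟩
      map_add' := fun x y => Subtype.ext (by simp)
      map_smul' := fun r x => Subtype.ext (by simp [Algebra.smul_def]) }
  obtain ⟨x, hx⟩ := h.exists_eq_smul I (f.restrictScalars R ∘ₗ ι)
  refine ⟨x, fun j => ?_⟩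
  obtain ⟨r, s, hrs⟩ := IsLocalization.exists_mk'_eq S (j : Localization S)
  have hsj : algebraMap R (Localization S) s * j = algebraMap R (Localization S) r := by
    rw [← hrs, IsLocalization.mk'_spec']
  have hr : r ∈ I := by
    change algebraMap R (Localization S) r ∈ J
    rw [← hsj]
    exact J.mul_mem_left _ j.2
  have hι : ι ⟨r, hr⟩ = algebraMap R (Localization S) s • j := Subtype.ext hsj.symm
  have hfr := hx ⟨r, hr⟩
  simp only [LinearMap.comp_apply, LinearMap.coe_restrictScalars, hι, map_smul] at hfr
  have hu : IsUnit (algebraMap R (Localization S) s) := IsLocalization.map_units _ s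
  rw [← hu.smul_left_cancel, hfr, smul_smul, hsj, algebraMap_smul]

end Module.Baer

/-! ### Torsion quotients over a valuation ring -/

section Local

variable {R : Type*} [CommRing R]

/-- Baer's criterion over `R ⧸ L` for an `R`-module `T` killed by `L`: if `T` embeds into `N` and
meets `L N` trivially, it is a direct summand of `N`, because it embeds into the
`R ⧸ L`-module `N ⧸ L N`. -/
theorem exists_leftInverse_of_disjoint_smul_top {L : Ideal R} {T N : Type*}
    [AddCommGroup T] [AddCommGroup N] [Module R T] [Module R N]
    (hT : ∀ l ∈ L, ∀ t : T, l • t = 0)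
    (hB : ∀ (J : Ideal R) (f : J →ₗ[R] T), (∀ l : J, (l : R) ∈ L → f l = 0) →
      ∃ t : T, ∀ j : J, f j = (j : R) • t)
    (j : T →ₗ[R] N) (hj : ∀ t, j t ∈ L • (⊤ : Submodule R N) → t = 0) :
    ∃ ρ : N →ₗ[R] T, ∀ t, ρ (j t) = t := by
  have hT' : Module.IsTorsionBySet R T (L : Set R) := fun t l => hT l l.2 t
  let _ : Module (R ⧸ L) T := hT'.module
  have hmk : ∀ (r : R) (t : T), Ideal.Quotient.mk L r • t = r • t := fun r t => rfl
  have hbaer : Module.Baer (R ⧸ L) T := by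
    refine Module.Baer.of_exists_eq_smul fun J f => ?_
    let g : J.comap (Ideal.Quotient.mk L) →ₗ[R] T :=
      { toFun := fun i => f ⟨Ideal.Quotient.mk L i, i.2⟩
        map_add' := fun x y => by rw [← map_add]; rfl
        map_smul' := fun r x => by
          rw [RingHom.id_apply, ← hmk, ← map_smul]; rfl }
    obtain ⟨t, ht⟩ := hB _ g fun l hl => by
      have : (⟨Ideal.Quotient.mk L l, l.2⟩ : J) = 0 :=
        Subtype.ext (Ideal.Quotient.eq_zero_iff_mem.mpr hl)
      change f ⟨Ideal.Quotient.mk L l, l.2⟩ = 0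
      rw [this, map_zero]
    refine ⟨t, ?_⟩
    rintro ⟨i, hi⟩
    obtain ⟨r, rfl⟩ := Ideal.Quotient.mk_surjective i
    exact ht ⟨r, hi⟩
  let k : T →ₗ[R ⧸ L] (N ⧸ L • (⊤ : Submodule R N)) :=
    { toFun := fun t => Submodule.Quotient.mk (j t)
      map_add' := fun x y => by simp
      map_smul' := fun r t => by
        obtain ⟨r, rfl⟩ := Ideal.Quotient.mk_surjective r
        rw [hmk, map_smul]; rfl }
  have hk : Function.Injective k := by
    rw [injective_iff_map_eq_zero]
    exact fun t ht => hj t ((Submodule.Quotient.mk_eq_zero _).mp ht)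
  obtain ⟨ρ, hρ⟩ := hbaer.extension_property k hk LinearMap.id
  refine ⟨{ toFun := fun n => ρ (Submodule.Quotient.mk n)
            map_add' := fun x y => by simp
            map_smul' := fun r n => ?_ }, fun t => LinearMap.congr_fun hρ t⟩
  rw [RingHom.id_apply, ← hmk, ← map_smul]; rfl

/-- The elements of `R` whose image in `R_P` divides no element of `S`, when divisibility in `R_P`
is total: the contraction to `R` of the largest prime of `R_P` that misses `S`. -/
def nonDivisorIdeal [IsDomain R] (P : Ideal R) [P.IsPrime] (S : Submonoid R) (hS : 0 ∉ S)
    (hP : ∀ a b : R, ∃ u ∉ P, ∃ c, u * a = b * c ∨ u * b = a * c) : Ideal R where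
  carrier := {r | ∀ s ∈ S, ∀ u ∉ P, ∀ c, r * c ≠ u * s}
  zero_mem' := fun s hs u hu c h => by
    rw [zero_mul, eq_comm, mul_eq_zero] at h
    rcases h with rfl | rfl
    exacts [hu P.zero_mem, hS hs]
  smul_mem' := fun x r hr s hs u hu c h =>
    hr s hs u hu (x * c) (by rw [← h, smul_eq_mul]; ring)
  add_mem' := fun {a b} ha hb s hs u hu c h => by
    obtain ⟨v, hv, d, hd | hd⟩ := hP a b
    · exact hb s hs (v * u) (fun h => (Ideal.IsPrime.mem_or_mem ‹_› h).elim hv hu)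
        ((d + v) * c) (by linear_combination v * h - hd * c)
    · exact ha s hs (v * u) (fun h => (Ideal.IsPrime.mem_or_mem ‹_› h).elim hv hu)
        ((d + v) * c) (by linear_combination v * h - hd * c)

/-- The case of a valuation ring. The `S`-torsion `T` of `E` is an injective module over the domain
`R ⧸ L`, where `L` is the largest prime missing `S`. Given `f : I → E ⧸ T`, the pullback `N` of `E`
along `f` is an extension of the flat module `I` by `T`, so `T` meets `L N` trivially and splits
off from `N`. Hence `f` lifts to `E`, where Baer's criterion applies. -/
theorem Module.Baer.quotient_torsion'_of_dvd_total [IsDomain R] (P : Ideal R) [P.IsPrime]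
    (hP : ∀ a b : R, ∃ u ∉ P, ∃ c, u * a = b * c ∨ u * b = a * c)
    {E : Type*} [AddCommGroup E] [Module R E] (hE : Module.Baer R E)
    (hu : ∀ u ∉ P, ∀ e : E, u • e = 0 → e = 0) (S : Submonoid R) (hS : 0 ∉ S) :
    Module.Baer R (E ⧸ Submodule.torsion' R E S) := by
  set T := Submodule.torsion' R E S with hTdef
  have memT : ∀ e : E, e ∈ T ↔ ∃ s ∈ S, s • e = 0 := fun e => by
    rw [hTdef, Submodule.mem_torsion'_iff]
    exact ⟨fun ⟨s, h⟩ => ⟨s, s.2, h⟩, fun ⟨s, hs, h⟩ => ⟨⟨s, hs⟩, h⟩⟩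
  set L := nonDivisorIdeal P S hS hP
  have memL : ∀ r : R, r ∉ L → ∃ s ∈ S, ∃ u ∉ P, ∃ c, r * c = u * s := fun r hr => by
    by_contra! h
    exact hr h
  have hLT : ∀ l ∈ L, ∀ t ∈ T, l • t = 0 := fun l hl t ht => by
    obtain ⟨s, hs, hst⟩ := (memT t).mp ht
    obtain ⟨u, hu', c, h | h⟩ := hP l s
    · refine hu u hu' _ ?_
      rw [smul_smul, h, mul_comm, mul_smul, hst, smul_zero]
    · exact absurd h.symm (hl s hs u hu' c)
  have hTB : ∀ (J : Ideal R) (f : J →ₗ[R] T), (∀ l : J, (l : R) ∈ L → f l = 0) →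
      ∃ t : T, ∀ j : J, f j = (j : R) • t := fun J f hf => by
    by_cases hJ : J ≤ L
    · exact ⟨0, fun j => by rw [hf j (hJ j.2), smul_zero]⟩
    obtain ⟨r, hrJ, hrL⟩ := SetLike.not_le_iff_exists.mp hJ
    obtain ⟨e, he⟩ := hE.exists_eq_smul J (T.subtype ∘ₗ f)
    suffices heT : e ∈ T from ⟨⟨e, heT⟩, fun j => Subtype.ext (he j)⟩
    have hre : r • e ∈ T := by
      have := he ⟨r, hrJ⟩
      simp only [LinearMap.comp_apply, Submodule.subtype_apply] at this
      rw [← this]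
      exact (f _).2
    -- Some multiple of `r` is `s` up to a factor outside `P`, so `r • e ∈ T` forces `e ∈ T`.
    obtain ⟨s', hs', h'⟩ := (memT _).mp hre
    obtain ⟨s, hs, u, hu', c, hc⟩ := memL r hrL
    refine (memT e).mpr ⟨s * s', S.mul_mem hs hs', hu u hu' _ ?_⟩
    rw [smul_smul, ← mul_assoc, ← hc, show r * c * s' = c * (s' * r) by ring, mul_smul, mul_smul,
      h', smul_zero]
  refine of_exists_eq_smul fun I f => ?_
  let N : Submodule R (I × E) :=
    LinearMap.eqLocus (f ∘ₗ LinearMap.fst R I E) (T.mkQ ∘ₗ LinearMap.snd R I E)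
  let j : T →ₗ[R] N := LinearMap.codRestrict N (LinearMap.inr R I E ∘ₗ T.subtype) fun t => by
    simpa [N, LinearMap.mem_eqLocus] using ((Submodule.Quotient.mk_eq_zero T).mpr t.2).symm
  have hN : ∀ n : N, f n.1.1 = T.mkQ n.1.2 := fun n => n.2
  -- In a valuation ring, every element of `L N` is a single product `l • n`.
  have hLN : ∀ x ∈ L • (⊤ : Submodule R N), ∃ v ∉ P, ∃ l ∈ L, ∃ n : N, v • x = l • n := by
    intro x hx
    have hmul : ∀ {a b}, a ∉ P → b ∉ P → a * b ∉ P := fun ha hb h =>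
      (Ideal.IsPrime.mem_or_mem ‹_› h).elim ha hb
    induction hx using Submodule.smul_induction_on' with
    | smul l hl n _ => exact ⟨1, (Ideal.ne_top_iff_one P).mp Ideal.IsPrime.ne_top', l, hl, n,
        one_smul _ _⟩
    | add x _ y _ hx hy =>
      obtain ⟨v, hv, l, hl, n, hn⟩ := hx
      obtain ⟨w, hw, m, hm, k, hk⟩ := hy
      obtain ⟨z, hz, c, h | h⟩ := hP l m
      · refine ⟨z * (v * w), hmul hz (hmul hv hw), m, hm, (c * w) • n + (z * v) • k, ?_⟩
        calc (z * (v * w)) • (x + y) = (z * w) • v • x + (z * v) • w • y := by module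
          _ = w • (z * l) • n + (z * v) • m • k := by rw [hn, hk]; module
          _ = m • ((c * w) • n + (z * v) • k) := by rw [h]; module
      · refine ⟨z * (v * w), hmul hz (hmul hv hw), l, hl, (z * w) • n + (c * v) • k, ?_⟩
        calc (z * (v * w)) • (x + y) = (z * w) • v • x + (z * v) • w • y := by module
          _ = (z * w) • l • n + v • (z * m) • k := by rw [hn, hk]; module
          _ = l • ((z * w) • n + (c * v) • k) := by rw [h]; module
  have hj : ∀ t, j t ∈ L • (⊤ : Submodule R N) → t = 0 := fun t ht => by
    obtain ⟨v, hv, l, hl, n, hn⟩ := hLN _ ht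
    have h1 : (0 : R) = l * n.1.1 := by
      simpa [j] using congrArg (fun n : N => ((n.1.1 : I) : R)) hn
    have h2 : v • (t : E) = l • n.1.2 := by
      simpa [j] using congrArg (fun n : N => n.1.2) hn
    refine Subtype.ext (hu v hv _ ?_)
    rw [h2]
    rcases mul_eq_zero.mp h1.symm with h | h
    · rw [h, zero_smul]
    · refine hLT l hl _ ?_
      have := hN n
      rw [show n.1.1 = 0 from Subtype.ext h, map_zero] at this
      exact (Submodule.Quotient.mk_eq_zero _).mp this.symm
  obtain ⟨ρ, hρ⟩ := exists_leftInverse_of_disjoint_smul_top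
    (fun l hl t => Subtype.ext (hLT l hl t t.2)) hTB j hj
  have hchoose : ∀ i : I, ∃ e : E, f i = T.mkQ e := fun i => by
    obtain ⟨e, he⟩ := T.mkQ_surjective (f i)
    exact ⟨e, he.symm⟩
  choose c hc using hchoose
  let σ : I → N := fun i => ⟨(i, c i), hc i⟩
  -- `e - ρ (i, e)` does not depend on the lift `e` of `f i`.
  have key : ∀ n : N, n.1.2 - (ρ n : E) = c n.1.1 - (ρ (σ n.1.1) : E) := by
    intro n
    have hd : n.1.2 - c n.1.1 ∈ T := by
      rw [← Submodule.Quotient.mk_eq_zero, ← Submodule.mkQ_apply, map_sub, ← hN n, ← hc, sub_self]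
    have h : n = σ n.1.1 + j ⟨_, hd⟩ := by
      apply Subtype.ext
      ext <;> simp [j, σ]
    have h' := congrArg (fun x => (ρ x : E)) h
    simp only [map_add, hρ, Submodule.coe_add] at h'
    rw [h']
    abel
  let g : I →ₗ[R] E :=
    { toFun := fun i => c i - (ρ (σ i) : E)
      map_add' := fun x y => by
        refine (key (σ x + σ y)).symm.trans ?_
        rw [map_add]
        change (c x + c y) - ((ρ (σ x) : E) + (ρ (σ y) : E)) = _
        abel
      map_smul' := fun r x => by
        refine (key (r • σ x)).symm.trans ?_
        rw [map_smul]
        exact (smul_sub r _ _).symm }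
  obtain ⟨e, he⟩ := hE.exists_eq_smul I g
  refine ⟨T.mkQ e, fun i => ?_⟩
  rw [← map_smul, ← he i, hc i]
  change _ = T.mkQ (c i - (ρ (σ i) : E))
  rw [map_sub, show T.mkQ (ρ (σ i) : E) = 0 from
    (Submodule.Quotient.mk_eq_zero _).mpr (ρ _).2, sub_zero]

end Local

/-! ### Products over the maximal ideals -/

section Global

variable {R : Type*} [CommRing R]

/-- Only the finitely many maximal ideals containing a chosen `a ∈ I` matter: at every other `P`,
`a` acts bijectively on `E P`, so that a map from `I` is determined there by its value at `a`. -/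
theorem Module.Baer.quotient_torsion'_pi [IsDomain R] [IsOfFiniteCharacterRing R]
    {E : MaximalSpectrum R → Type*} [∀ P, AddCommGroup (E P)] [∀ P, Module R (E P)]
    (hE : ∀ P, Module.Baer R (E P))
    (hu : ∀ (P : MaximalSpectrum R), ∀ u ∉ P.asIdeal, ∀ e : E P, u • e = 0 → e = 0)
    (S : Submonoid R) (hT : ∀ P, Module.Baer R (E P ⧸ Submodule.torsion' R (E P) S)) :
    Module.Baer R ((∀ P, E P) ⧸ Submodule.torsion' R (∀ P, E P) S) := by
  classical
  refine of_exists_eq_smul fun I f => ?_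
  by_cases hI : I = ⊥
  · subst hI
    exact ⟨0, fun i => by rw [Subsingleton.elim i 0, map_zero, smul_zero]⟩
  obtain ⟨a, haI, ha⟩ := Submodule.exists_mem_ne_zero_of_ne_bot hI
  have hfin : {P : MaximalSpectrum R | a ∈ P.asIdeal}.Finite :=
    Set.Finite.of_finite_image (f := MaximalSpectrum.asIdeal)
      ((IsOfFiniteCharacterRing.finite_maximal a ha).subset
        (by rintro _ ⟨P, hP, rfl⟩; exact ⟨P.isMaximal, hP⟩))
      (fun P _ Q _ h => MaximalSpectrum.ext h)
  have hlift : ∀ i : I, ∃ m : ∀ P, E P, (Submodule.torsion' R (∀ P, E P) S).mkQ m = f i :=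
    fun i => Submodule.mkQ_surjective _ (f i)
  choose m hm using hlift
  let π : ∀ P, ((∀ P, E P) ⧸ Submodule.torsion' R (∀ P, E P) S) →ₗ[R]
      (E P ⧸ Submodule.torsion' R (E P) S) := fun P =>
    Submodule.mapQ _ _ (LinearMap.proj P) (by
      rintro x ⟨s, hs⟩
      exact ⟨s, congrFun hs P⟩)
  have hx : ∀ P, ∃ x : E P, (a ∈ P.asIdeal → ∀ i : I, ∃ s ∈ S, s • (m i P - (i : R) • x) = 0) ∧
      (a ∉ P.asIdeal → a • x = m ⟨a, haI⟩ P) := fun P => by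
    by_cases haP : a ∈ P.asIdeal
    · obtain ⟨y, hy⟩ := (hT P).exists_eq_smul I (π P ∘ₗ f)
      obtain ⟨x, rfl⟩ := Submodule.mkQ_surjective _ y
      refine ⟨x, fun _ i => ?_, fun h => absurd haP h⟩
      have h := hy i
      rw [LinearMap.comp_apply, ← hm, Submodule.mkQ_apply, Submodule.mapQ_apply,
        ← map_smul, Submodule.mkQ_apply, Submodule.Quotient.eq] at h
      obtain ⟨s, hs⟩ := h
      exact ⟨s, s.2, hs⟩
    · obtain ⟨x, hx⟩ := (hE P).exists_smul_eq ha (m ⟨a, haI⟩ P)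
      exact ⟨x, fun h => absurd h haP, fun _ => hx⟩
  choose x hx1 hx2 using hx
  refine ⟨Submodule.mkQ _ x, fun i => ?_⟩
  rw [← hm, ← map_smul, Submodule.mkQ_apply, Submodule.mkQ_apply, Submodule.Quotient.eq]
  have h0 : a • m i - (i : R) • m ⟨a, haI⟩ ∈ Submodule.torsion' R (∀ P, E P) S := by
    rw [← Submodule.Quotient.mk_eq_zero, ← Submodule.mkQ_apply, map_sub, map_smul, map_smul, hm,
      hm, ← map_smul, ← map_smul, sub_eq_zero]
    congr 1
    exact Subtype.ext (mul_comm _ _)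
  obtain ⟨s₀, hs₀⟩ := h0
  have hs : ∀ P, ∃ s ∈ S, a ∈ P.asIdeal → s • (m i P - (i : R) • x P) = 0 := fun P => by
    by_cases haP : a ∈ P.asIdeal
    · obtain ⟨s, hs, h⟩ := hx1 P haP i
      exact ⟨s, hs, fun _ => h⟩
    · exact ⟨1, S.one_mem, fun h => absurd h haP⟩
  choose s hsS hs using hs
  refine ⟨s₀ * ∏ P ∈ hfin.toFinset, (⟨s P, hsS P⟩ : S), ?_⟩
  funext P
  simp only [Submonoid.smul_def, Pi.smul_apply, Pi.sub_apply, Pi.zero_apply, Submonoid.coe_mul,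
    Submonoid.coe_finsetProd]
  by_cases haP : a ∈ P.asIdeal
  · rw [← Finset.prod_erase_mul _ _ (hfin.mem_toFinset.mpr haP), ← mul_assoc, mul_smul, hs P haP,
      smul_zero]
  · refine hu P a haP _ ?_
    have h := congrFun hs₀ P
    simp only [Submonoid.smul_def, Pi.smul_apply, Pi.sub_apply, Pi.zero_apply] at h
    rw [← hx2 P haP] at h
    rw [mul_comm (s₀ : R), mul_smul, smul_comm a,
      show a • (s₀ : R) • (m i P - (i : R) • x P) = (s₀ : R) • (a • m i P - (i : R) • a • x P) by
        module, h, smul_zero]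

/-- The Pontryagin dual of `R_P`. -/
abbrev LocalDual (P : MaximalSpectrum R) : Type _ :=
  CharacterModule (Localization.AtPrime P.asIdeal)

theorem LocalDual.baer (P : MaximalSpectrum R) : Module.Baer R (LocalDual P) :=
  Module.Flat.iff_characterModule_baer.mp
    (IsLocalization.flat (Localization.AtPrime P.asIdeal) P.asIdeal.primeCompl)

theorem LocalDual.eq_zero_of_smul_eq_zero (P : MaximalSpectrum R) {u : R} (hu : u ∉ P.asIdeal)
    {e : LocalDual P} (h : u • e = 0) : e = 0 := by
  ext y
  have hunit : IsUnit (algebraMap R (Localization.AtPrime P.asIdeal) u) :=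
    IsLocalization.map_units _ (⟨u, hu⟩ : P.asIdeal.primeCompl)
  obtain ⟨v, hv⟩ := hunit.exists_right_inv
  have := DFunLike.congr_fun h (v * y)
  rwa [CharacterModule.smul_apply, Algebra.smul_def, ← mul_assoc, hv, one_mul] at this

/-- Evaluation of `G` into the product, over all maximal ideals `P`, of copies of the
Pontryagin dual of `R_P`, one for each homomorphism from `G`. -/
def evalLocalDual (R : Type*) [CommRing R] (G : Type*) [AddCommGroup G] [Module R G] :
    G →ₗ[R] (∀ P : MaximalSpectrum R, (G →ₗ[R] LocalDual P) → LocalDual P) :=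
  LinearMap.pi fun _ => LinearMap.pi fun φ => φ

theorem evalLocalDual_injective (G : Type*) [AddCommGroup G] [Module R G] :
    Function.Injective (evalLocalDual R G) := by
  rw [injective_iff_map_eq_zero]
  intro g hg
  refine Module.eq_zero_of_localization_maximal (fun (P : Ideal R) _ => LocalizedModule P.primeCompl G)
    (fun P _ => LocalizedModule.mkLinearMap (R := R) P.primeCompl G) g fun P hP => ?_
  refine CharacterModule.eq_zero_of_character_apply fun c => ?_
  let φ : G →ₗ[R] LocalDual (⟨P, hP⟩ : MaximalSpectrum R) :=
    { toFun := fun g => c.comp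
        (LinearMap.toSpanSingleton (Localization.AtPrime P) (LocalizedModule P.primeCompl G)
          (LocalizedModule.mkLinearMap P.primeCompl G g)).toAddMonoidHom
      map_add' := fun x y => by
        ext z
        change c (z • _) = c (z • _) + c (z • _)
        rw [map_add, smul_add, map_add]
      map_smul' := fun r x => by
        ext z
        change c (z • _) = c ((r • z) • _)
        rw [LinearMap.map_smul, smul_comm, smul_assoc] }
  have h : φ g = 0 := congrFun (congrFun hg ⟨P, hP⟩) φ
  have h1 : c ((1 : Localization.AtPrime P) • LocalizedModule.mkLinearMap P.primeCompl G g) = 0 :=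
    DFunLike.congr_fun h (1 : Localization.AtPrime P)
  rwa [one_smul] at h1

/-- Divisibility in the valuation ring `R_P` is total; here denominators are cleared. -/
theorem IsPruferDomain.dvd_total [IsPruferDomain R] (P : Ideal R) [P.IsMaximal] (a b : R) :
    ∃ u ∉ P, ∃ c, u * a = b * c ∨ u * b = a * c := by
  have hle : P.primeCompl ≤ nonZeroDivisors R := P.primeCompl_le_nonZeroDivisors
  have key : ∀ a b : R, algebraMap R (Localization.AtPrime P) b ∣ algebraMap R (Localization.AtPrime P) a →
      ∃ u ∉ P, ∃ c, u * a = b * c := fun a b ⟨z, hz⟩ => by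
    obtain ⟨c, u, rfl⟩ := IsLocalization.exists_mk'_eq P.primeCompl z
    refine ⟨u, u.2, c, IsLocalization.injective (Localization.AtPrime P) hle ?_⟩
    rw [map_mul, map_mul, hz, mul_left_comm, IsLocalization.mk'_spec']
  have := IsPruferDomain.valuationRing_localization P
  rcases ValuationRing.dvd_total (algebraMap R (Localization.AtPrime P) b)
    (algebraMap R (Localization.AtPrime P) a) with h | h
  · obtain ⟨u, hu, c, hc⟩ := key a b h
    exact ⟨u, hu, c, .inl hc⟩
  · obtain ⟨u, hu, c, hc⟩ := key b a h
    exact ⟨u, hu, c, .inr hc⟩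

theorem Module.Baer.localizedModule_of_isPruferDomain [IsPruferDomain R]
    [IsOfFiniteCharacterRing R] {G : Type*} [AddCommGroup G] [Module R G] (hG : Module.Baer R G)
    (S : Submonoid R) : Module.Baer R (LocalizedModule S G) := by
  by_cases hS : 0 ∈ S
  · have : Subsingleton (LocalizedModule S G) := LocalizedModule.subsingleton hS
    exact fun I f => ⟨0, fun x hx => Subsingleton.elim _ _⟩
  obtain ⟨r, hr⟩ := hG.extension_property _ (evalLocalDual_injective G) LinearMap.id
  refine hG.localizedModule S hS (quotient_torsion'_of_leftInverse S ?_ (evalLocalDual R G) r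
    fun m => LinearMap.congr_fun hr m)
  have hE : ∀ P : MaximalSpectrum R, Module.Baer R ((G →ₗ[R] LocalDual P) → LocalDual P) :=
    fun P => .pi fun _ => LocalDual.baer P
  have hu : ∀ (P : MaximalSpectrum R), ∀ u ∉ P.asIdeal,
      ∀ e : (G →ₗ[R] LocalDual P) → LocalDual P, u • e = 0 → e = 0 := fun P u hu e h =>
    funext fun φ => LocalDual.eq_zero_of_smul_eq_zero P hu (congrFun h φ)
  refine quotient_torsion'_pi hE hu S fun P => ?_
  have := P.isMaximal
  exact quotient_torsion'_of_dvd_total P.asIdeal (IsPruferDomain.dvd_total P.asIdeal)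
    (hE P) (hu P) S hS

end Global

theorem theoremT {R : Type u} [CommRing R] [IsPruferDomain R] [IsOfFiniteCharacterRing R]
    (G : Type v) [AddCommGroup G] [Module R G] [Small.{v} R] (hG : Module.Injective R G)
    (S : Submonoid R) :
    Module.Injective (Localization S) (LocalizedModule S G) ∧
      Module.Injective R (LocalizedModule S G) := by
  have h := (Module.Baer.of_injective hG).localizedModule_of_isPruferDomain S
  exact ⟨h.localization.injective, h.injective⟩
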